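/- For $n\ge 1$ let $H_n=\sum_{j=1}^{n}\frac1j$, and let the Bernoulli numbers $B_n$ be defined by $\frac{x}{e^x-1}=\sum_{n\ge 0}B_n\frac{x^n}{n!}$. For a prime $p$, $r\ge 1$ and rational numbers $\frac uv,\frac st$ in lowest terms, the congruence $\frac uv\equiv\frac st\pmod{p^r}$ means that $p\nmid v$, $p\nmid t$ and $ut\equiv sv\pmod{p^r}$ in $\mathbb Z$. Let $p\ge 7$ be a prime. Then $$\sum_{k=1}^{p-1}\frac{H_k^2}{k}\equiv\sum_{k=1}^{p-1}\frac{H_k}{k^2}\equiv 3\left(\frac{B_{2p-4}}{2p-4}-\frac{2B_{p-3}}{p-3}\right)\pmod{p^2}.$$ In particular, $$\sum_{k=1}^{p-1}\frac{H_k^2}{k}\equiv\sum_{k=1}^{p-1}\frac{H_k}{k^2}\equiv B_{p-3}\pmod{p}.$$ -/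

import Mathlib

/-- Congruence of rational numbers modulo `m`: both denominators (in lowest terms) are prime to `m`,
and `u / v ≡ r / s` means `u * s ≡ r * v` as integers modulo `m`. -/
def RatModEq (m : ℕ) (a b : ℚ) : Prop :=
  a.den.Coprime m ∧ b.den.Coprime m ∧
    a.num * (b.den : ℤ) ≡ b.num * (a.den : ℤ) [ZMOD (m : ℤ)]

/-! Let S = ∑ H_k²/k, T = ∑ H_k/k² and h_s = ∑ 1/k^s over 1 ≤ k ≤ p-1, and b_m = B_m/m. Congruences
are treated as membership of differences in `padicMultiples`, so they combine by subgroup and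
product rules.

Telescoping H_k³ gives 3(S - T) = h_1³ - h_3. Pairing k with p-k shows that h_1 and h_3 vanish mod
p², hence S ≡ T.

The value comes from (-1)^k C(p-1,k) ≡ 1 - pH_k + p²(H_k² - H_k^(2))/2 mod p³, where H_k^(2) =
∑_{j≤k} 1/j². The alternating binomial transforms of 1/k² and of H_k/k are known exactly. The first
yields 2pT ≡ 3h_2 + p²E mod p³ with E = ∑ (H_k² - H_k^(2))/k². Comparing it with the second, and
using S ≡ T, gives E ≡ F mod p, where F = ∑ (H_k² - H_k^(2))H_k/k. Telescoping gives F ≡ 2E, so E ≡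
0 and 2pT ≡ 3h_2 mod p³.

It remains to see that h_2 ≡ 2p(b_{2p-4} - 2b_{p-3}) mod p³. By Fermat, 1/k² is mod p³ a combination
of k^{p-3}, k^{2p-4}, k^{3p-5}; their sums are pB_m mod p³, and a second-order Kummer congruence
eliminates b_{3p-5}. Kummer's congruences are derived from Voronoi's, with base 2^p and modulus p².
Mod p, b_{2p-4} ≡ b_{p-3} turns the value into -3b_{p-3} ≡ B_{p-3}. -/

section

open Finset

/-- The rational numbers whose `p`-adic valuation is at least `r`. -/
def padicMultiples (p : ℕ) [Fact p.Prime] (r : ℕ) : AddSubgroup ℚ where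
  carrier := {x | padicNorm p x ≤ (p : ℚ) ^ (-(r : ℤ))}
  add_mem' ha hb := padicNorm.nonarchimedean.trans (max_le ha hb)
  zero_mem' := by
    simp only [Set.mem_ofPred_eq, padicNorm.zero]
    positivity
  neg_mem' h := by simpa using h

/-! ### Arithmetic of p-adic congruences between rationals. -/

section padicMultiples

variable {p : ℕ} [hp : Fact p.Prime] {r s : ℕ} {x y : ℚ}

theorem mem_padicMultiples_iff :
    x ∈ padicMultiples p r ↔ padicNorm p x ≤ (p : ℚ) ^ (-(r : ℤ)) := Iff.rfl

theorem mul_mem_padicMultiples (hx : x ∈ padicMultiples p r) (hy : y ∈ padicMultiples p s) :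
    x * y ∈ padicMultiples p (r + s) := by
  have hp0 : (p : ℚ) ≠ 0 := by exact_mod_cast hp.out.ne_zero
  rw [mem_padicMultiples_iff] at *
  rw [padicNorm.mul, Nat.cast_add, neg_add, zpow_add₀ hp0]
  exact mul_le_mul hx hy (padicNorm.nonneg _) (by positivity)

theorem mul_mem_padicMultiples_left (hx : x ∈ padicMultiples p 0)
    (hy : y ∈ padicMultiples p r) : x * y ∈ padicMultiples p r := by
  simpa using mul_mem_padicMultiples hx hy

theorem mul_mem_padicMultiples_right (hx : x ∈ padicMultiples p r)
    (hy : y ∈ padicMultiples p 0) : x * y ∈ padicMultiples p r := by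
  simpa using mul_mem_padicMultiples hx hy

theorem padicMultiples_anti (h : s ≤ r) (hx : x ∈ padicMultiples p r) :
    x ∈ padicMultiples p s := by
  rw [mem_padicMultiples_iff] at *
  refine hx.trans (zpow_le_zpow_right₀ ?_ (by omega))
  exact_mod_cast hp.out.one_le

theorem intCast_mem_padicMultiples_iff {z : ℤ} :
    (z : ℚ) ∈ padicMultiples p r ↔ (p : ℤ) ^ r ∣ z := by
  rw [mem_padicMultiples_iff, ← padicNorm.dvd_iff_norm_le]
  push_cast
  rfl

theorem intCast_mem_padicMultiples_zero (z : ℤ) : (z : ℚ) ∈ padicMultiples p 0 := by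
  simp [intCast_mem_padicMultiples_iff]

theorem natCast_mem_padicMultiples_zero (k : ℕ) : (k : ℚ) ∈ padicMultiples p 0 := by
  exact_mod_cast intCast_mem_padicMultiples_zero (k : ℤ)

theorem pow_mem_padicMultiples_zero (hx : x ∈ padicMultiples p 0) (n : ℕ) :
    x ^ n ∈ padicMultiples p 0 := by
  induction n with
  | zero => simpa using natCast_mem_padicMultiples_zero (p := p) 1
  | succ n ih => simpa [pow_succ] using mul_mem_padicMultiples ih hx

theorem prime_pow_mem_padicMultiples (r : ℕ) : (p : ℚ) ^ r ∈ padicMultiples p r := by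
  have h : (((p : ℤ) ^ r : ℤ) : ℚ) ∈ padicMultiples p r :=
    intCast_mem_padicMultiples_iff.2 dvd_rfl
  exact_mod_cast h

theorem prime_mem_padicMultiples : (p : ℚ) ∈ padicMultiples p 1 := by
  simpa using prime_pow_mem_padicMultiples (p := p) 1

theorem mem_padicMultiples_of_prime_pow_mul (k : ℕ)
    (h : (p : ℚ) ^ k * x ∈ padicMultiples p (r + k)) : x ∈ padicMultiples p r := by
  have hp0 : (p : ℚ) ≠ 0 := by exact_mod_cast hp.out.ne_zero
  have hp1 : (0 : ℚ) < p := by exact_mod_cast hp.out.pos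
  rw [mem_padicMultiples_iff] at *
  have hk : padicNorm p ((p : ℚ) ^ k) = (p : ℚ) ^ (-(k : ℤ)) := by
    have : padicNorm p ((p : ℚ) ^ k) = padicNorm p p ^ k :=
      map_pow (IsAbsoluteValue.toAbsoluteValue (padicNorm p)) _ _
    rw [this, padicNorm.padicNorm_p_of_prime, inv_pow, zpow_neg, zpow_natCast]
  rw [padicNorm.mul, hk, Nat.cast_add, neg_add, zpow_add₀ hp0, mul_comm] at h
  exact le_of_mul_le_mul_right h (by positivity)

theorem mem_padicMultiples_of_prime_mul
    (h : (p : ℚ) * x ∈ padicMultiples p (r + 1)) : x ∈ padicMultiples p r :=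
  mem_padicMultiples_of_prime_pow_mul 1 (by simpa using h)

theorem inv_intCast_mem_padicMultiples_zero {z : ℤ} (hz : ¬ (p : ℤ) ∣ z) :
    (z : ℚ)⁻¹ ∈ padicMultiples p 0 := by
  rw [mem_padicMultiples_iff, ← one_div, padicNorm.div, (padicNorm.int_eq_one_iff z).2 hz]
  simp

theorem inv_natCast_mem_padicMultiples_zero {k : ℕ} (hk : ¬ p ∣ k) :
    (k : ℚ)⁻¹ ∈ padicMultiples p 0 := by
  have := inv_intCast_mem_padicMultiples_zero (p := p) (z := k) (by exact_mod_cast hk)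
  exact_mod_cast this

theorem inv_natCast_mem_padicMultiples_zero_of_lt {k : ℕ} (h0 : 0 < k) (hk : k < p) :
    (k : ℚ)⁻¹ ∈ padicMultiples p 0 :=
  inv_natCast_mem_padicMultiples_zero fun h => (Nat.le_of_dvd h0 h).not_gt hk

theorem mem_padicMultiples_of_intCast_mul {z : ℤ} (hz : ¬ (p : ℤ) ∣ z)
    (h : (z : ℚ) * x ∈ padicMultiples p r) : x ∈ padicMultiples p r := by
  have hz0 : (z : ℚ) ≠ 0 := by
    rintro h0
    exact hz (by rw [Int.cast_eq_zero.1 h0]; exact dvd_zero _)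
  have := mul_mem_padicMultiples_left (inv_intCast_mem_padicMultiples_zero hz) h
  rwa [inv_mul_cancel_left₀ hz0] at this

theorem mem_padicMultiples_of_natCast_mul {k : ℕ} (h0 : 0 < k) (hk : k < p)
    (h : (k : ℚ) * x ∈ padicMultiples p r) : x ∈ padicMultiples p r := by
  refine mem_padicMultiples_of_intCast_mul (z := k) ?_ (by exact_mod_cast h)
  exact_mod_cast fun h => (Nat.le_of_dvd h0 h).not_gt hk

theorem mem_padicMultiples_zero_iff_den_coprime :
    x ∈ padicMultiples p 0 ↔ x.den.Coprime p := by
  constructor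
  · intro h
    rw [Nat.coprime_comm, hp.out.coprime_iff_not_dvd]
    intro hd
    have hnum : (x.num : ℚ) ∈ padicMultiples p 1 := by
      rw [← Rat.mul_den_eq_num x]
      refine mul_mem_padicMultiples_left h ?_
      have : ((x.den : ℤ) : ℚ) ∈ padicMultiples p 1 :=
        intCast_mem_padicMultiples_iff.2 (by simpa using (by exact_mod_cast hd))
      exact_mod_cast this
    rw [intCast_mem_padicMultiples_iff, pow_one] at hnum
    have h1 := Nat.dvd_gcd (Int.natCast_dvd.1 hnum) hd
    rw [x.reduced] at h1
    exact hp.out.one_lt.ne' (Nat.dvd_one.1 h1)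
  · intro h
    have h1 := inv_natCast_mem_padicMultiples_zero
      (hp.out.coprime_iff_not_dvd.1 (Nat.coprime_comm.1 h))
    have := mul_mem_padicMultiples (intCast_mem_padicMultiples_zero (p := p) x.num) h1
    rwa [← div_eq_mul_inv, Rat.num_div_den] at this

theorem ratModEq_of_sub_mem (hx : x ∈ padicMultiples p 0) (hy : y ∈ padicMultiples p 0)
    (h : x - y ∈ padicMultiples p r) : RatModEq (p ^ r) x y := by
  have h1 := Nat.Coprime.pow_right r (mem_padicMultiples_zero_iff_den_coprime.1 hx)
  have h2 := Nat.Coprime.pow_right r (mem_padicMultiples_zero_iff_den_coprime.1 hy)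
  refine ⟨h1, h2, ?_⟩
  refine (Int.modEq_iff_dvd.2 ?_).symm
  rw [Nat.cast_pow, ← intCast_mem_padicMultiples_iff]
  have h3 : (x - y) * ((x.den : ℚ) * (y.den : ℚ)) ∈ padicMultiples p r :=
    mul_mem_padicMultiples_right h (mul_mem_padicMultiples (r := 0) (s := 0)
      (natCast_mem_padicMultiples_zero x.den) (natCast_mem_padicMultiples_zero y.den))
  have h4 : (x - y) * ((x.den : ℚ) * (y.den : ℚ)) =
      ((x.num * (y.den : ℤ) - y.num * (x.den : ℤ) : ℤ) : ℚ) := by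
    push_cast
    linear_combination (y.den : ℚ) * Rat.mul_den_eq_num x - (x.den : ℚ) * Rat.mul_den_eq_num y
  rwa [h4] at h3

end padicMultiples

/-- The `n`-th generalized harmonic number of exponent `s`. -/
def powerHarmonic (s n : ℕ) : ℚ := ∑ i ∈ range n, ((i + 1 : ℕ) : ℚ)⁻¹ ^ s

theorem powerHarmonic_succ (s n : ℕ) :
    powerHarmonic s (n + 1) = powerHarmonic s n + ((n + 1 : ℕ) : ℚ)⁻¹ ^ s :=
  sum_range_succ _ _

theorem powerHarmonic_one (n : ℕ) : powerHarmonic 1 n = harmonic n := by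
  simp [powerHarmonic, harmonic]

/-! ### Telescoping identities for harmonic sums. -/

section Telescoping

theorem sum_harmonic_div_eq (n : ℕ) :
    2 * ∑ i ∈ range n, harmonic (i + 1) * ((i + 1 : ℕ) : ℚ)⁻¹ =
      harmonic n ^ 2 + powerHarmonic 2 n := by
  induction n with
  | zero => simp [powerHarmonic]
  | succ n ih =>
    rw [sum_range_succ, mul_add, ih, harmonic_succ, powerHarmonic_succ]
    ring

/-- Sums the increments H_k³ - (H_k - 1/k)³. At n = p - 1 the right side vanishes mod p². -/
theorem sum_harmonic_sq_div_sub_eq (n : ℕ) :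
    3 * ∑ i ∈ range n, harmonic (i + 1) ^ 2 * ((i + 1 : ℕ) : ℚ)⁻¹
      - 3 * ∑ i ∈ range n, harmonic (i + 1) * ((i + 1 : ℕ) : ℚ)⁻¹ ^ 2 =
      harmonic n ^ 3 - powerHarmonic 3 n := by
  induction n with
  | zero => simp [powerHarmonic]
  | succ n ih =>
    rw [sum_range_succ, sum_range_succ, powerHarmonic_succ]
    simp only [harmonic_succ] at ih ⊢
    linear_combination ih

theorem sum_harmonic_cube_div_eq (n : ℕ) :
    4 * ∑ i ∈ range n, harmonic (i + 1) ^ 3 * ((i + 1 : ℕ) : ℚ)⁻¹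
      - 6 * ∑ i ∈ range n, harmonic (i + 1) ^ 2 * ((i + 1 : ℕ) : ℚ)⁻¹ ^ 2
      + 4 * ∑ i ∈ range n, harmonic (i + 1) * ((i + 1 : ℕ) : ℚ)⁻¹ ^ 3 =
      harmonic n ^ 4 + powerHarmonic 4 n := by
  induction n with
  | zero => simp [powerHarmonic]
  | succ n ih =>
    rw [sum_range_succ, sum_range_succ, sum_range_succ, powerHarmonic_succ]
    simp only [harmonic_succ] at ih ⊢
    linear_combination ih

theorem sum_powerHarmonic_two_div_sq_eq (n : ℕ) :
    2 * ∑ i ∈ range n, powerHarmonic 2 (i + 1) * ((i + 1 : ℕ) : ℚ)⁻¹ ^ 2 =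
      powerHarmonic 2 n ^ 2 + powerHarmonic 4 n := by
  induction n with
  | zero => simp [powerHarmonic]
  | succ n ih =>
    rw [sum_range_succ, mul_add, ih, powerHarmonic_succ, powerHarmonic_succ]
    ring

theorem sum_harmonic_mul_powerHarmonic_two_div_eq (n : ℕ) :
    2 * ∑ i ∈ range n, harmonic (i + 1) * powerHarmonic 2 (i + 1) * ((i + 1 : ℕ) : ℚ)⁻¹
      + ∑ i ∈ range n, harmonic (i + 1) ^ 2 * ((i + 1 : ℕ) : ℚ)⁻¹ ^ 2
      - 2 * ∑ i ∈ range n, harmonic (i + 1) * ((i + 1 : ℕ) : ℚ)⁻¹ ^ 3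
      - ∑ i ∈ range n, powerHarmonic 2 (i + 1) * ((i + 1 : ℕ) : ℚ)⁻¹ ^ 2 + powerHarmonic 4 n =
      harmonic n ^ 2 * powerHarmonic 2 n := by
  induction n with
  | zero => simp [powerHarmonic]
  | succ n ih =>
    rw [sum_range_succ, sum_range_succ, sum_range_succ, sum_range_succ, powerHarmonic_succ 4]
    simp only [harmonic_succ, powerHarmonic_succ 2] at ih ⊢
    linear_combination ih

end Telescoping

/-! ### Alternating binomial transforms of harmonic sequences. -/

section BinomialTransform

/-- The alternating binomial transform `∑ (-1) ^ (k - 1) * n.choose k * a k` over `1 ≤ k ≤ n`. -/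
def altBinomialSum (a : ℕ → ℚ) (n : ℕ) : ℚ :=
  ∑ i ∈ range n, (-1) ^ i * (n.choose (i + 1) : ℚ) * a (i + 1)

theorem altBinomialSum_succ (a : ℕ → ℚ) (n : ℕ) :
    altBinomialSum a (n + 1) =
      altBinomialSum a n + ∑ i ∈ range (n + 1), (-1) ^ i * (n.choose i : ℚ) * a (i + 1) := by
  have h : altBinomialSum a n =
      ∑ i ∈ range (n + 1), (-1) ^ i * (n.choose (i + 1) : ℚ) * a (i + 1) := by
    rw [sum_range_succ, Nat.choose_succ_self]
    simp [altBinomialSum]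
  rw [h, altBinomialSum, ← sum_add_distrib]
  refine sum_congr rfl fun i _ => ?_
  rw [Nat.choose_succ_succ]
  push_cast
  ring

theorem sum_alternating_choose_mul_inv (a : ℕ → ℚ) (n : ℕ) :
    ∑ i ∈ range (n + 1), (-1) ^ i * (n.choose i : ℚ) * (a (i + 1) * ((i + 1 : ℕ) : ℚ)⁻¹) =
      altBinomialSum a (n + 1) * ((n + 1 : ℕ) : ℚ)⁻¹ := by
  rw [altBinomialSum, sum_mul]
  refine sum_congr rfl fun i _ => ?_
  have h := Nat.add_one_mul_choose_eq n i
  have h' : ((n + 1 : ℕ) : ℚ) * (n.choose i : ℚ) =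
      ((n + 1).choose (i + 1) : ℚ) * ((i + 1 : ℕ) : ℚ) := by exact_mod_cast h
  have h1 : ((n + 1 : ℕ) : ℚ) ≠ 0 := by positivity
  have h2 : ((i + 1 : ℕ) : ℚ) ≠ 0 := by positivity
  field_simp
  linear_combination a (i + 1) * h'

/-- By Pascal's rule the increment of the transform is a sum against C(n,i), and C(n,i)/(i+1) =
C(n+1,i+1)/(n+1) turns that sum back into a transform. -/
theorem altBinomialSum_mul_inv (a : ℕ → ℚ) (n : ℕ) :
    altBinomialSum (fun k => a k * (k : ℚ)⁻¹) n =
      ∑ i ∈ range n, altBinomialSum a (i + 1) * ((i + 1 : ℕ) : ℚ)⁻¹ := by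
  induction n with
  | zero => simp [altBinomialSum]
  | succ n ih =>
    rw [altBinomialSum_succ, ih, sum_alternating_choose_mul_inv, ← sum_range_succ]

theorem altBinomialSum_one (n : ℕ) : altBinomialSum (fun _ => 1) (n + 1) = 1 := by
  induction n with
  | zero => simp [altBinomialSum]
  | succ n ih =>
    rw [altBinomialSum_succ, ih]
    have h := Int.alternating_sum_range_choose_of_ne (n := n + 1) (by omega)
    have h' : ∑ i ∈ range (n + 1 + 1), (-1 : ℚ) ^ i * ((n + 1).choose i : ℚ) = 0 := by
      exact_mod_cast h
    simpa using h'

/-- In Pascal's recursion, split H_{i+1} = H_i + 1/(i+1): the H_i part cancels the transform at n,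
and the rest is the transform of 1 divided by n+1. -/
theorem altBinomialSum_harmonic (n : ℕ) :
    altBinomialSum harmonic (n + 1) = ((n + 1 : ℕ) : ℚ)⁻¹ := by
  have h : ∑ i ∈ range (n + 1), (-1) ^ i * (n.choose i : ℚ) * harmonic i =
      -altBinomialSum harmonic n := by
    rw [sum_range_succ', altBinomialSum, ← sum_neg_distrib]
    simp [pow_succ]
  have h2 := sum_alternating_choose_mul_inv (fun _ => 1) n
  simp only [altBinomialSum_one, one_mul] at h2
  rw [altBinomialSum_succ]
  simp only [harmonic_succ, mul_add, sum_add_distrib]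
  rw [h]
  linear_combination h2

theorem altBinomialSum_inv_sq (n : ℕ) :
    2 * altBinomialSum (fun k => (k : ℚ)⁻¹ ^ 2) n = harmonic n ^ 2 + powerHarmonic 2 n := by
  have h1 (n : ℕ) : altBinomialSum (fun k => (k : ℚ)⁻¹) n = harmonic n := by
    have h := altBinomialSum_mul_inv (fun _ => 1) n
    simp only [altBinomialSum_one, one_mul] at h
    exact h
  have h := altBinomialSum_mul_inv (fun k => (k : ℚ)⁻¹) n
  simp only [h1, ← pow_two] at h
  rw [h, sum_harmonic_div_eq]

theorem altBinomialSum_harmonic_mul_inv (n : ℕ) :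
    altBinomialSum (fun k => harmonic k * (k : ℚ)⁻¹) n = powerHarmonic 2 n := by
  rw [altBinomialSum_mul_inv]
  simp only [altBinomialSum_harmonic, ← pow_two]
  rfl

end BinomialTransform

/-! ### Harmonic sums modulo powers of p. -/

section ModPrime

/-- For k = i + 1 the other index is p - k, in the shape produced by `sum_range_reflect`. -/
theorem inv_reflect_add_inv {p i : ℕ} (hi : i < p - 1) :
    ((p - 1 - 1 - i + 1 : ℕ) : ℚ)⁻¹ + ((i + 1 : ℕ) : ℚ)⁻¹ =
      p * (((i + 1 : ℕ) : ℚ)⁻¹ * ((p - 1 - 1 - i + 1 : ℕ) : ℚ)⁻¹) := by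
  have h : ((p - 1 - 1 - i + 1 : ℕ) : ℚ) = p - ((i + 1 : ℕ) : ℚ) := by
    rw [← Nat.cast_sub (by omega)]
    congr 1
    omega
  have h1 : ((p - 1 - 1 - i + 1 : ℕ) : ℚ) ≠ 0 := by positivity
  have h2 : ((i + 1 : ℕ) : ℚ) ≠ 0 := by positivity
  field_simp
  rw [h]
  ring

variable {p : ℕ} [hp : Fact p.Prime]

theorem inv_succ_mem_padicMultiples_zero {i : ℕ} (hi : i < p - 1) :
    ((i + 1 : ℕ) : ℚ)⁻¹ ∈ padicMultiples p 0 :=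
  inv_natCast_mem_padicMultiples_zero_of_lt (by omega) (by omega)

theorem powerHarmonic_mem_padicMultiples_zero (s : ℕ) {n : ℕ} (hn : n ≤ p - 1) :
    powerHarmonic s n ∈ padicMultiples p 0 :=
  sum_mem fun i hi => pow_mem_padicMultiples_zero
    (inv_succ_mem_padicMultiples_zero (by have := mem_range.1 hi; omega)) s

theorem harmonic_mem_padicMultiples_zero {n : ℕ} (hn : n ≤ p - 1) :
    harmonic n ∈ padicMultiples p 0 := by
  rw [← powerHarmonic_one]
  exact powerHarmonic_mem_padicMultiples_zero 1 hn

theorem sum_pow_range_mem_padicMultiples_one {m : ℕ} (hm : m < p - 1) :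
    ∑ k ∈ range p, (k : ℚ) ^ m ∈ padicMultiples p 1 := by
  have h : ∑ k ∈ range p, (k : ZMod p) ^ m = 0 := by
    have h1 := FiniteField.sum_pow_lt_card_sub_one (ZMod p) m (by rwa [ZMod.card])
    rw [← h1]
    refine sum_bij' (fun k _ => (k : ZMod p)) (fun x _ => x.val) (by simp)
      (fun x _ => mem_range.2 (ZMod.val_lt x)) (fun k hk => ZMod.val_cast_of_lt (mem_range.1 hk))
      (fun x _ => ZMod.natCast_zmod_val x) (by simp)
  have h2 : ((∑ k ∈ range p, k ^ m : ℕ) : ZMod p) = 0 := by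
    push_cast
    exact h
  rw [ZMod.natCast_eq_zero_iff] at h2
  have h3 : (((∑ k ∈ range p, k ^ m : ℕ) : ℤ) : ℚ) ∈ padicMultiples p 1 :=
    intCast_mem_padicMultiples_iff.2 (by rw [pow_one]; exact_mod_cast h2)
  exact_mod_cast h3

theorem natCast_pow_card_sub_one_sub_one_mem {k : ℕ} (h0 : 0 < k) (hk : k < p) :
    (k : ℚ) ^ (p - 1) - 1 ∈ padicMultiples p 1 := by
  have h : (((k : ℤ) ^ (p - 1) - 1 : ℤ) : ℚ) ∈ padicMultiples p 1 := by
    rw [intCast_mem_padicMultiples_iff, pow_one, ← Int.modEq_iff_dvd]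
    refine (Int.ModEq.pow_card_sub_one_eq_one hp.out ?_).symm
    rw [Int.isCoprime_iff_gcd_eq_one]
    rw [Int.gcd_natCast_natCast]
    exact (hp.out.coprime_iff_not_dvd.2 fun h => (Nat.le_of_dvd h0 h).not_gt hk).symm
  exact_mod_cast h

/-- By Fermat k^{-s} ≡ k^{p-1-s}, and power sums of exponent below p - 1 vanish mod p. -/
theorem powerHarmonic_mem_padicMultiples_one {s : ℕ} (hs : 0 < s) (hsp : s < p - 1) :
    powerHarmonic s (p - 1) ∈ padicMultiples p 1 := by
  have h1 := sum_pow_range_mem_padicMultiples_one (p := p) (m := p - 1 - s) (by omega)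
  rw [show range p = range (p - 1 + 1) by rw [Nat.sub_add_cancel hp.out.one_le],
    sum_range_succ'] at h1
  rw [Nat.cast_zero, zero_pow (by omega), add_zero] at h1
  rw [← sub_sub_cancel (∑ k ∈ range (p - 1), ((k + 1 : ℕ) : ℚ) ^ (p - 1 - s))
    (powerHarmonic s (p - 1))]
  refine sub_mem h1 ?_
  rw [powerHarmonic, ← sum_sub_distrib]
  refine sum_mem fun i hi => ?_
  have hi' := mem_range.1 hi
  have h3 := mul_mem_padicMultiples_left
    (pow_mem_padicMultiples_zero (inv_succ_mem_padicMultiples_zero hi') s)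
    (natCast_pow_card_sub_one_sub_one_mem (p := p) (k := i + 1) (by omega) (by omega))
  convert h3 using 1
  have h2 : ((i + 1 : ℕ) : ℚ) ≠ 0 := by positivity
  rw [mul_sub, mul_one, show p - 1 = s + (p - 1 - s) by omega, pow_add, Nat.add_sub_cancel_left,
    inv_pow, inv_mul_cancel_left₀ (pow_ne_zero _ h2)]

theorem harmonic_mem_padicMultiples_two (hp5 : 5 ≤ p) :
    harmonic (p - 1) ∈ padicMultiples p 2 := by
  refine mem_padicMultiples_of_natCast_mul (k := 2) (by omega) (by omega) ?_
  have h : (2 : ℕ) * harmonic (p - 1) =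
      ∑ i ∈ range (p - 1), (p : ℚ) ^ 2 * (((i + 1 : ℕ) : ℚ)⁻¹ ^ 2 *
        ((p - 1 - 1 - i + 1 : ℕ) : ℚ)⁻¹) - p * powerHarmonic 2 (p - 1) := by
    have h0 := sum_range_reflect (fun i => ((i + 1 : ℕ) : ℚ)⁻¹) (p - 1)
    have h1 : (2 : ℕ) * harmonic (p - 1) = ∑ i ∈ range (p - 1),
        (((p - 1 - 1 - i + 1 : ℕ) : ℚ)⁻¹ + ((i + 1 : ℕ) : ℚ)⁻¹) := by
      rw [sum_add_distrib, h0, harmonic]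
      push_cast
      ring
    rw [h1, powerHarmonic, mul_sum, ← sum_sub_distrib]
    refine sum_congr rfl fun i hi => ?_
    have h2 := inv_reflect_add_inv (mem_range.1 hi)
    -- With t = 1/k and u = 1/(p-k), the relation u + t = ptu is used twice, giving u + t = p²t²u -
    -- pt².
    linear_combination (1 + (p : ℚ) * ((i + 1 : ℕ) : ℚ)⁻¹) * h2
  rw [h]
  refine sub_mem (sum_mem fun i hi => ?_) ?_
  · have hi' := mem_range.1 hi
    exact mul_mem_padicMultiples_right (prime_pow_mem_padicMultiples 2)
      (mul_mem_padicMultiples_left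
        (pow_mem_padicMultiples_zero (inv_succ_mem_padicMultiples_zero hi') 2)
        (inv_succ_mem_padicMultiples_zero (by omega)))
  · exact mul_mem_padicMultiples (r := 1) (s := 1) prime_mem_padicMultiples
      (powerHarmonic_mem_padicMultiples_one (by omega) (by omega))

/-- Pairing k with p - k, the sum of inverse cubes is -3p/k⁴ mod p², and h_4 ≡ 0 mod p. -/
theorem powerHarmonic_three_mem_padicMultiples_two (hp7 : 7 ≤ p) :
    powerHarmonic 3 (p - 1) ∈ padicMultiples p 2 := by
  refine mem_padicMultiples_of_natCast_mul (k := 2) (by omega) (by omega) ?_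
  have h : (2 : ℕ) * powerHarmonic 3 (p - 1) =
      ∑ i ∈ range (p - 1), (p : ℚ) ^ 2 * (((i + 1 : ℕ) : ℚ)⁻¹ ^ 2 *
        ((p - 1 - 1 - i + 1 : ℕ) : ℚ)⁻¹ * (((p - 1 - 1 - i + 1 : ℕ) : ℚ)⁻¹ ^ 2 -
          ((2 : ℕ) : ℚ) * (((i + 1 : ℕ) : ℚ)⁻¹ * ((p - 1 - 1 - i + 1 : ℕ) : ℚ)⁻¹) +
          ((3 : ℕ) : ℚ) * ((i + 1 : ℕ) : ℚ)⁻¹ ^ 2))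
        - (3 : ℕ) * (p * powerHarmonic 4 (p - 1)) := by
    have h0 := sum_range_reflect (fun i => ((i + 1 : ℕ) : ℚ)⁻¹ ^ 3) (p - 1)
    have h1 : (2 : ℕ) * powerHarmonic 3 (p - 1) = ∑ i ∈ range (p - 1),
        (((p - 1 - 1 - i + 1 : ℕ) : ℚ)⁻¹ ^ 3 + ((i + 1 : ℕ) : ℚ)⁻¹ ^ 3) := by
      rw [sum_add_distrib, h0, powerHarmonic]
      push_cast
      ring
    rw [h1, powerHarmonic, mul_sum, mul_sum, ← sum_sub_distrib]
    refine sum_congr rfl fun i hi => ?_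
    have h2 := inv_reflect_add_inv (mem_range.1 hi)
    generalize ((p - 1 - 1 - i + 1 : ℕ) : ℚ)⁻¹ = u at *
    generalize ((i + 1 : ℕ) : ℚ)⁻¹ = t at *
    push_cast
    linear_combination (u ^ 2 - t * u + t ^ 2 + p * t * (u ^ 2 - 2 * t * u + 3 * t ^ 2)) * h2
  rw [h]
  refine sub_mem (sum_mem fun i hi => ?_) ?_
  · have hi' := mem_range.1 hi
    have ht := inv_succ_mem_padicMultiples_zero hi'
    have hu := inv_succ_mem_padicMultiples_zero (p := p) (i := p - 1 - 1 - i) (by omega)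
    refine mul_mem_padicMultiples_right (prime_pow_mem_padicMultiples 2)
      (mul_mem_padicMultiples_left (mul_mem_padicMultiples_left
        (pow_mem_padicMultiples_zero ht 2) hu) ?_)
    exact add_mem (sub_mem (pow_mem_padicMultiples_zero hu 2)
      (mul_mem_padicMultiples_left (natCast_mem_padicMultiples_zero 2)
        (mul_mem_padicMultiples_left ht hu)))
      (mul_mem_padicMultiples_left (natCast_mem_padicMultiples_zero 3)
        (pow_mem_padicMultiples_zero ht 2))
  · exact mul_mem_padicMultiples_left (natCast_mem_padicMultiples_zero 3)
      (mul_mem_padicMultiples (r := 1) (s := 1) prime_mem_padicMultiples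
        (powerHarmonic_mem_padicMultiples_one (by omega) (by omega)))

theorem harmonic_reflect_sub_mem (hp5 : 5 ≤ p) {j : ℕ} (hj : j ≤ p - 1) :
    harmonic (p - 1 - j) - harmonic j ∈ padicMultiples p 1 := by
  induction j with
  | zero => simpa using padicMultiples_anti (by omega) (harmonic_mem_padicMultiples_two hp5)
  | succ j ih =>
    have h1 := ih (by omega)
    have h2 := inv_reflect_add_inv (p := p) (i := j) (by omega)
    have h3 : ((p - 1 - 1 - j + 1 : ℕ) : ℚ)⁻¹ + ((j + 1 : ℕ) : ℚ)⁻¹ ∈ padicMultiples p 1 := by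
      rw [h2]
      exact mul_mem_padicMultiples_right prime_mem_padicMultiples
        (mul_mem_padicMultiples_left (inv_succ_mem_padicMultiples_zero (by omega))
          (inv_succ_mem_padicMultiples_zero (by omega)))
    have h4 := sub_mem h1 h3
    rw [show p - 1 - j = p - 1 - 1 - j + 1 by omega, harmonic_succ] at h4
    rw [show p - 1 - (j + 1) = p - 1 - 1 - j by omega, harmonic_succ]
    convert h4 using 1
    ring

/-- Under k ↦ p - k one has H_{p-k} ≡ H_{k-1}, so ∑ H_k²/k² ≡ ∑ (H_k - 1/k)²/k². Expanding leaves 2∑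
H_k/k³ ≡ h_4 ≡ 0. -/
theorem sum_harmonic_div_cube_mem (hp7 : 7 ≤ p) :
    ∑ i ∈ range (p - 1), harmonic (i + 1) * ((i + 1 : ℕ) : ℚ)⁻¹ ^ 3 ∈ padicMultiples p 1 := by
  have h0 := sum_range_reflect (fun i => harmonic (i + 1) ^ 2 * ((i + 1 : ℕ) : ℚ)⁻¹ ^ 2) (p - 1)
  have h1 : ∑ i ∈ range (p - 1), (harmonic (p - 1 - 1 - i + 1) ^ 2 *
      ((p - 1 - 1 - i + 1 : ℕ) : ℚ)⁻¹ ^ 2 - harmonic i ^ 2 * ((i + 1 : ℕ) : ℚ)⁻¹ ^ 2) ∈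
      padicMultiples p 1 := by
    refine sum_mem fun i hi => ?_
    have hi' := mem_range.1 hi
    have ht := inv_succ_mem_padicMultiples_zero hi'
    have hu := inv_succ_mem_padicMultiples_zero (p := p) (i := p - 1 - 1 - i) (by omega)
    have hH := harmonic_mem_padicMultiples_zero (p := p) (n := i) (by omega)
    have hG := harmonic_mem_padicMultiples_zero (p := p) (n := p - 1 - 1 - i + 1) (by omega)
    have h2 : ((p - 1 - 1 - i + 1 : ℕ) : ℚ)⁻¹ + ((i + 1 : ℕ) : ℚ)⁻¹ ∈ padicMultiples p 1 := by
      rw [inv_reflect_add_inv hi']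
      exact mul_mem_padicMultiples_right prime_mem_padicMultiples
        (mul_mem_padicMultiples_left ht hu)
    have h3 := harmonic_reflect_sub_mem (by omega) hi'.le
    rw [show p - 1 - i = p - 1 - 1 - i + 1 by omega] at h3
    have h4 := add_mem
      (mul_mem_padicMultiples_right h3
        (mul_mem_padicMultiples_left (add_mem hG hH) (pow_mem_padicMultiples_zero hu 2)))
      (mul_mem_padicMultiples_right h2
        (mul_mem_padicMultiples_left (sub_mem hu ht) (pow_mem_padicMultiples_zero hH 2)))
    convert h4 using 1
    ring
  rw [sum_sub_distrib, h0, ← sum_sub_distrib] at h1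
  refine mem_padicMultiples_of_natCast_mul (k := 2) (by omega) (by omega) ?_
  have h2 := add_mem h1 (powerHarmonic_mem_padicMultiples_one (p := p) (s := 4) (by omega)
    (by omega))
  convert h2 using 1
  rw [powerHarmonic, ← sum_add_distrib, mul_sum]
  refine sum_congr rfl fun i _ => ?_
  rw [harmonic_succ]
  push_cast
  ring

/-- The left term is ∏_{j≤k} (1 - p/j), expanded to second order in p. -/
theorem neg_one_pow_mul_choose_sub_mem (hp3 : 3 ≤ p) {k : ℕ} (hk : k ≤ p - 1) :
    (-1) ^ k * ((p - 1).choose k : ℚ) - (1 - p * harmonic k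
      + p ^ 2 * ((harmonic k ^ 2 - powerHarmonic 2 k) * (2 : ℚ)⁻¹)) ∈ padicMultiples p 3 := by
  induction k with
  | zero => simp [powerHarmonic]
  | succ k ih =>
    have h1 := ih (by omega)
    have ht := inv_succ_mem_padicMultiples_zero (p := p) (i := k) (by omega)
    have hH := harmonic_mem_padicMultiples_zero (p := p) (n := k) (by omega)
    have hG := powerHarmonic_mem_padicMultiples_zero (p := p) 2 (n := k) (by omega)
    have h2 : (2 : ℚ)⁻¹ ∈ padicMultiples p 0 :=
      inv_natCast_mem_padicMultiples_zero_of_lt (k := 2) (by omega) (by omega)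
    have hone : (1 : ℚ) ∈ padicMultiples p 0 := by
      exact_mod_cast natCast_mem_padicMultiples_zero (p := p) 1
    have h3 : ((p - 1).choose (k + 1) : ℚ) =
        ((p - 1).choose k : ℚ) * (p * ((k + 1 : ℕ) : ℚ)⁻¹ - 1) := by
      have h := Nat.choose_succ_right_eq (p - 1) k
      have h' : ((p - 1).choose (k + 1) : ℚ) * ((k + 1 : ℕ) : ℚ) =
          ((p - 1).choose k : ℚ) * (p - ((k + 1 : ℕ) : ℚ)) := by
        rw [← Nat.cast_sub (by omega), show p - (k + 1) = p - 1 - k by omega]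
        exact_mod_cast h
      have h0 : ((k + 1 : ℕ) : ℚ) ≠ 0 := by positivity
      field_simp
      linear_combination h'
    have h4 := sub_mem (mul_mem_padicMultiples_right h1 (sub_mem hone
        (mul_mem_padicMultiples_left (natCast_mem_padicMultiples_zero p) ht)))
      (mul_mem_padicMultiples_right (prime_pow_mem_padicMultiples 3)
        (mul_mem_padicMultiples_left ht
          (mul_mem_padicMultiples_right (sub_mem (pow_mem_padicMultiples_zero hH 2) hG) h2)))
    rw [h3, harmonic_succ, powerHarmonic_succ]
    convert h4 using 1
    ring

theorem altBinomialSum_add_mem (hp3 : 3 ≤ p) {a : ℕ → ℚ}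
    (ha : ∀ i < p - 1, a (i + 1) ∈ padicMultiples p 0) :
    altBinomialSum a (p - 1) + ∑ i ∈ range (p - 1), a (i + 1)
      - p * ∑ i ∈ range (p - 1), harmonic (i + 1) * a (i + 1)
      + p ^ 2 * ∑ i ∈ range (p - 1),
        (harmonic (i + 1) ^ 2 - powerHarmonic 2 (i + 1)) * (2 : ℚ)⁻¹ * a (i + 1) ∈
      padicMultiples p 3 := by
  rw [altBinomialSum, mul_sum, mul_sum, ← sum_add_distrib, ← sum_sub_distrib, ← sum_add_distrib]
  refine sum_mem fun i hi => ?_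
  have hi' := mem_range.1 hi
  have h := mul_mem_padicMultiples_right
    (neg_mem (neg_one_pow_mul_choose_sub_mem hp3 (k := i + 1) (by omega))) (ha i hi')
  convert h using 1
  ring

/-- The hypothesis is E ≡ F. Since ∑ H_k/k³ and ∑ H_k^(2)/k² vanish mod p, the telescoped H_k⁴ and
H_k²H_k^(2) identities give F ≡ 2E, which forces E ≡ 0. -/
theorem sum_harmonic_sq_sub_powerHarmonic_div_sq_mem (hp7 : 7 ≤ p)
    (h : ∑ i ∈ range (p - 1), (harmonic (i + 1) ^ 2 - powerHarmonic 2 (i + 1)) *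
        ((i + 1 : ℕ) : ℚ)⁻¹ ^ 2 - ∑ i ∈ range (p - 1),
        (harmonic (i + 1) ^ 2 - powerHarmonic 2 (i + 1)) *
          (harmonic (i + 1) * ((i + 1 : ℕ) : ℚ)⁻¹) ∈ padicMultiples p 1) :
    ∑ i ∈ range (p - 1), (harmonic (i + 1) ^ 2 - powerHarmonic 2 (i + 1)) *
        ((i + 1 : ℕ) : ℚ)⁻¹ ^ 2 ∈ padicMultiples p 1 := by
  have hn (k : ℕ) := natCast_mem_padicMultiples_zero (p := p) k
  have hZ := sum_harmonic_div_cube_mem hp7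
  have h4 := powerHarmonic_mem_padicMultiples_one (p := p) (s := 4) (by omega) (by omega)
  have h2 := powerHarmonic_mem_padicMultiples_one (p := p) (s := 2) (by omega) (by omega)
  have h20 := padicMultiples_anti (Nat.zero_le 1) h2
  have hH := padicMultiples_anti (show 1 ≤ 2 by omega)
    (harmonic_mem_padicMultiples_two (p := p) (by omega))
  have hH0 := padicMultiples_anti (Nat.zero_le 1) hH
  have eW := sum_powerHarmonic_two_div_sq_eq (p - 1)
  have eQ := sum_harmonic_cube_div_eq (p - 1)
  have eY := sum_harmonic_mul_powerHarmonic_two_div_eq (p - 1)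
  have hW : ∑ i ∈ range (p - 1), powerHarmonic 2 (i + 1) * ((i + 1 : ℕ) : ℚ)⁻¹ ^ 2 ∈
      padicMultiples p 1 := by
    refine mem_padicMultiples_of_natCast_mul (k := 2) (by omega) (by omega) ?_
    rw [Nat.cast_ofNat, eW, pow_two]
    exact add_mem (mul_mem_padicMultiples_left h20 h2) h4
  have hH4 : harmonic (p - 1) ^ 4 + powerHarmonic 4 (p - 1) ∈ padicMultiples p 1 := by
    rw [pow_succ]
    exact add_mem (mul_mem_padicMultiples_left (pow_mem_padicMultiples_zero hH0 3) hH) h4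
  have hHh : harmonic (p - 1) ^ 2 * powerHarmonic 2 (p - 1) - powerHarmonic 4 (p - 1) ∈
      padicMultiples p 1 :=
    sub_mem (mul_mem_padicMultiples_left (pow_mem_padicMultiples_zero hH0 2) h2) h4
  refine mem_padicMultiples_of_natCast_mul (k := 4) (by omega) (by omega) ?_
  have key := add_mem (sub_mem (sub_mem (mul_mem_padicMultiples_left (hn 8) hZ)
    (mul_mem_padicMultiples_left (hn 6) hW)) (mul_mem_padicMultiples_left (hn 4) h))
    (sub_mem (mul_mem_padicMultiples_left (hn 2) hHh) hH4)
  convert key using 1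
  simp only [sub_mul, sum_sub_distrib, ← mul_assoc, ← pow_succ] at eQ eY ⊢
  have eY' : ∑ i ∈ range (p - 1), powerHarmonic 2 (i + 1) * harmonic (i + 1) *
      ((i + 1 : ℕ) : ℚ)⁻¹ = ∑ i ∈ range (p - 1), harmonic (i + 1) * powerHarmonic 2 (i + 1) *
      ((i + 1 : ℕ) : ℚ)⁻¹ := sum_congr rfl fun i _ => by ring
  rw [eY']
  push_cast at eQ eY ⊢
  linear_combination 2 * eY - eQ

theorem sum_harmonic_sq_div_sub_mem (hp7 : 7 ≤ p) :
    ∑ i ∈ range (p - 1), harmonic (i + 1) ^ 2 * ((i + 1 : ℕ) : ℚ)⁻¹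
      - ∑ i ∈ range (p - 1), harmonic (i + 1) * ((i + 1 : ℕ) : ℚ)⁻¹ ^ 2 ∈
      padicMultiples p 2 := by
  refine mem_padicMultiples_of_natCast_mul (k := 3) (by omega) (by omega) ?_
  have hH := harmonic_mem_padicMultiples_two (p := p) (by omega)
  rw [mul_sub, Nat.cast_ofNat, sum_harmonic_sq_div_sub_eq, pow_succ]
  exact sub_mem (mul_mem_padicMultiples_left (pow_mem_padicMultiples_zero
    (padicMultiples_anti (Nat.zero_le 2) hH) 2) hH) (powerHarmonic_three_mem_padicMultiples_two hp7)

theorem prime_mul_sum_harmonic_div_sq_sub_mem (hp7 : 7 ≤ p) :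
    2 * (p * ∑ i ∈ range (p - 1), harmonic (i + 1) * ((i + 1 : ℕ) : ℚ)⁻¹ ^ 2)
      - 3 * powerHarmonic 2 (p - 1) ∈ padicMultiples p 3 := by
  have hn (k : ℕ) := natCast_mem_padicMultiples_zero (p := p) k
  have h2 : (2 : ℚ)⁻¹ ∈ padicMultiples p 0 :=
    inv_natCast_mem_padicMultiples_zero_of_lt (k := 2) (by omega) (by omega)
  have hH := harmonic_mem_padicMultiples_two (p := p) (by omega)
  have hHH : harmonic (p - 1) ^ 2 ∈ padicMultiples p 3 := by
    rw [pow_two]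
    exact padicMultiples_anti (by omega) (mul_mem_padicMultiples hH hH)
  have e1 := altBinomialSum_inv_sq (p - 1)
  have e2 := altBinomialSum_harmonic_mul_inv (p - 1)
  have e3 := sum_harmonic_div_eq (p - 1)
  have m1 := altBinomialSum_add_mem (p := p) (a := fun k => (k : ℚ)⁻¹ ^ 2) (by omega)
    fun i hi => pow_mem_padicMultiples_zero (inv_succ_mem_padicMultiples_zero hi) 2
  have m2 := altBinomialSum_add_mem (p := p) (a := fun k => harmonic k * (k : ℚ)⁻¹) (by omega)
    fun i hi => mul_mem_padicMultiples_left (harmonic_mem_padicMultiples_zero (by omega))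
      (inv_succ_mem_padicMultiples_zero hi)
  have m3 := mul_mem_padicMultiples (prime_mem_padicMultiples (p := p))
    (sum_harmonic_sq_div_sub_mem hp7)
  simp only [mul_right_comm _ (2 : ℚ)⁻¹, ← sum_mul, ← mul_assoc, ← pow_two] at m1 m2
  have hh : ∑ i ∈ range (p - 1), ((i + 1 : ℕ) : ℚ)⁻¹ ^ 2 = powerHarmonic 2 (p - 1) := rfl
  rw [hh] at m1
  -- Subtracting the two expansions leaves p²(E - F) and 2p(S - T); the latter vanishes mod p³.
  have h := sum_harmonic_sq_sub_powerHarmonic_div_sq_mem hp7 (by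
    refine mem_padicMultiples_of_prime_pow_mul 2 ?_
    have := add_mem (mul_mem_padicMultiples_left (hn 2) (sub_mem m1 m2))
      (neg_mem (mul_mem_padicMultiples_left (hn 2) m3))
    convert this using 1
    simp only [← mul_assoc]
    push_cast at e1 e2 e3 ⊢
    linear_combination 2 * e2 - e1 + e3)
  have := sub_mem (mul_mem_padicMultiples (prime_pow_mem_padicMultiples 2) h)
    (sub_mem (mul_mem_padicMultiples_left (hn 2) m1) hHH)
  convert this using 1
  push_cast at e1 e2 e3 ⊢
  linear_combination e1

end ModPrime

/-! ### Power sums and denominators of Bernoulli numbers. -/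

section Bernoulli

theorem sum_range_pow_eq_sum_choose_div (n m : ℕ) :
    ∑ k ∈ range n, (k : ℚ) ^ m =
      ∑ t ∈ range (m + 1), bernoulli (m - t) * (m.choose t : ℚ) * (n : ℚ) ^ (t + 1) *
        ((t + 1 : ℕ) : ℚ)⁻¹ := by
  rw [sum_range_pow, ← sum_range_reflect]
  refine sum_congr rfl fun t ht => ?_
  have ht' : t ≤ m := Nat.lt_succ_iff.1 (mem_range.1 ht)
  rw [show m + 1 - 1 - t = m - t by omega, show m + 1 - (m - t) = t + 1 by omega,
    show (m + 1).choose (m - t) = (m + 1).choose (t + 1) by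
      rw [← Nat.choose_symm (show t + 1 ≤ m + 1 by omega)]
      congr 1
      omega]
  have h : ((m + 1 : ℕ) : ℚ) * (m.choose t : ℚ) =
      ((m + 1).choose (t + 1) : ℚ) * ((t + 1 : ℕ) : ℚ) := by
    exact_mod_cast Nat.add_one_mul_choose_eq m t
  have h1 : ((m + 1 : ℕ) : ℚ) ≠ 0 := by positivity
  have h2 : ((t + 1 : ℕ) : ℚ) ≠ 0 := by positivity
  rw [show (m : ℚ) + 1 = ((m + 1 : ℕ) : ℚ) by push_cast; ring]
  field_simp
  linear_combination -bernoulli (m - t) * (n : ℚ) ^ (t + 1) * h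

variable {p : ℕ} [hp : Fact p.Prime]

theorem sum_one_div_primes_mem {s : Finset ℕ} (hs : ∀ q ∈ s, q.Prime ∧ q ≠ p) :
    ∑ q ∈ s, (1 : ℚ) / q ∈ padicMultiples p 0 := by
  refine sum_mem fun q hq => ?_
  rw [one_div]
  exact inv_natCast_mem_padicMultiples_zero fun h =>
    (hs q hq).2 ((Nat.prime_dvd_prime_iff_eq hp.out (hs q hq).1).1 h).symm

theorem bernoulli_mem_padicMultiples_zero (hp3 : 3 ≤ p) {k : ℕ} (hk : ¬ (p - 1) ∣ k) :
    bernoulli k ∈ padicMultiples p 0 := by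
  rcases Nat.even_or_odd' k with ⟨l, rfl | rfl⟩
  · obtain ⟨z, hz⟩ := Bernoulli.vonStaudt_clausen l
    rw [← add_sub_cancel_right (bernoulli (2 * l)) (∑ q ∈ range (2 * l + 2) with
      q.Prime ∧ (q - 1) ∣ 2 * l, (1 : ℚ) / q), ← hz]
    refine sub_mem (intCast_mem_padicMultiples_zero z) (sum_one_div_primes_mem fun q hq => ?_)
    rw [mem_filter] at hq
    refine ⟨hq.2.1, ?_⟩
    rintro rfl
    exact hk hq.2.2
  · rcases Nat.eq_zero_or_pos l with rfl | hl
    · rw [mul_zero, zero_add, bernoulli_one, neg_div, one_div]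
      exact neg_mem (inv_natCast_mem_padicMultiples_zero_of_lt (k := 2) (by omega) (by omega))
    · rw [bernoulli_eq_zero_of_odd ⟨l, rfl⟩ (by omega)]
      exact zero_mem _

theorem prime_mul_bernoulli_mem_padicMultiples_zero (hp3 : 3 ≤ p) (k : ℕ) :
    p * bernoulli k ∈ padicMultiples p 0 := by
  by_cases hk : (p - 1) ∣ k
  swap
  · exact mul_mem_padicMultiples_left (natCast_mem_padicMultiples_zero p)
      (bernoulli_mem_padicMultiples_zero hp3 hk)
  have hev : Even k := (hp.out.even_sub_one (by omega)).trans_dvd hk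
  obtain ⟨l, rfl⟩ := hev.two_dvd
  obtain ⟨z, hz⟩ := Bernoulli.vonStaudt_clausen l
  rw [← add_sub_cancel_right (bernoulli (2 * l)) (∑ q ∈ range (2 * l + 2) with
    q.Prime ∧ (q - 1) ∣ 2 * l, (1 : ℚ) / q), ← hz, mul_sub, mul_sum]
  refine sub_mem (mul_mem_padicMultiples_left (natCast_mem_padicMultiples_zero p)
    (intCast_mem_padicMultiples_zero z)) (sum_mem fun q hq => ?_)
  by_cases hqp : q = p
  · rw [hqp, mul_one_div_cancel (by exact_mod_cast hp.out.ne_zero)]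
    exact_mod_cast natCast_mem_padicMultiples_zero (p := p) 1
  · rw [one_div]
    exact mul_mem_padicMultiples_left (natCast_mem_padicMultiples_zero p)
      (inv_natCast_mem_padicMultiples_zero fun h =>
        hqp ((Nat.prime_dvd_prime_iff_eq hp.out (mem_filter.1 hq).2.1).1 h).symm)

/-- Controls the denominators in the power-sum formula: if p^v exactly divides t + 1 with v ≥ 1,
then v + 4 ≤ 7^v ≤ t + 1, so v ≤ t - 3. -/
theorem prime_pow_mul_inv_succ_mem (hp7 : 7 ≤ p) {t : ℕ} (ht : 3 ≤ t) :
    (p : ℚ) ^ (t - 3) * ((t + 1 : ℕ) : ℚ)⁻¹ ∈ padicMultiples p 0 := by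
  obtain ⟨v, c, hc, hvc⟩ := Nat.exists_eq_pow_mul_and_not_dvd (Nat.succ_ne_zero t) p hp.out.ne_one
  have hp0 : (p : ℚ) ≠ 0 := by exact_mod_cast hp.out.ne_zero
  have hv : v ≤ t - 3 := by
    rcases Nat.eq_zero_or_pos v with rfl | hv0
    · omega
    have hc0 : 0 < c := Nat.pos_of_ne_zero (by rintro rfl; simp at hc)
    have h1 : p ^ v ≤ t + 1 := by
      rw [← Nat.succ_eq_add_one, hvc]
      exact Nat.le_mul_of_pos_right _ hc0
    have h2 : 7 ^ v ≤ p ^ v := Nat.pow_le_pow_left hp7 v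
    have h3 : v + 4 ≤ 7 ^ v := by
      clear * - hv0
      induction v, hv0 using Nat.le_induction with
      | base => norm_num
      | succ n hn ih => rw [pow_succ]; omega
    omega
  rw [← Nat.succ_eq_add_one, hvc]
  have h : (p : ℚ) ^ (t - 3) * ((p ^ v * c : ℕ) : ℚ)⁻¹ = (p : ℚ) ^ (t - 3 - v) * (c : ℚ)⁻¹ := by
    push_cast
    rw [← Nat.sub_add_cancel hv, pow_add, Nat.add_sub_cancel]
    field_simp
  rw [h]
  exact mul_mem_padicMultiples_left (padicMultiples_anti (Nat.zero_le _)
    (prime_pow_mem_padicMultiples _)) (inv_natCast_mem_padicMultiples_zero hc)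

/-- The linear term is moved to the left; the quadratic one vanishes because m - 1 is odd and at
least 3. -/
theorem sum_range_pow_sub_eq {n m : ℕ} (hm : Even m) (hm4 : 4 ≤ m) :
    ∑ k ∈ range n, (k : ℚ) ^ m - n * bernoulli m =
      ∑ t ∈ range (m - 1), bernoulli (m - (t + 2)) * (m.choose (t + 2) : ℚ) *
        (n : ℚ) ^ (t + 2 + 1) * ((t + 2 + 1 : ℕ) : ℚ)⁻¹ := by
  rw [sum_range_pow_eq_sum_choose_div, show m + 1 = m - 1 + 1 + 1 by omega, sum_range_succ',
    sum_range_succ', zero_add, bernoulli_eq_zero_of_odd (n := m - 1) (by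
      rw [Nat.odd_sub' (by omega)]; simp [hm]) (by omega)]
  rw [Nat.sub_zero, Nat.choose_zero_right]
  push_cast
  simp only [add_assoc, Nat.reduceAdd]
  norm_num
  ring

/-- The sum of the `m`-th powers below `p` is `p * bernoulli m` modulo `p ^ 3`. -/
theorem sum_range_pow_sub_mem_padicMultiples_three (hp7 : 7 ≤ p) {m : ℕ} (hm : Even m)
    (hm4 : 4 ≤ m) (hB : ¬ (p - 1) ∣ m - 2) :
    ∑ k ∈ range p, (k : ℚ) ^ m - p * bernoulli m ∈ padicMultiples p 3 := by
  rw [sum_range_pow_sub_eq hm hm4]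
  refine sum_mem fun t _ => ?_
  have hc := natCast_mem_padicMultiples_zero (p := p) (m.choose (t + 2))
  rcases Nat.eq_zero_or_pos t with rfl | ht
  -- The cubic term has no power of p to spare, so B_{m-2} itself must be p-integral.
  · have h3 := inv_natCast_mem_padicMultiples_zero_of_lt (p := p) (k := 3) (by omega) (by omega)
    exact mul_mem_padicMultiples_right (mul_mem_padicMultiples_left (mul_mem_padicMultiples_left
      (bernoulli_mem_padicMultiples_zero (by omega) hB) hc) (prime_pow_mem_padicMultiples 3)) h3
  · have h := mul_mem_padicMultiples_left (mul_mem_padicMultiples_left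
      (prime_mul_bernoulli_mem_padicMultiples_zero (p := p) (by omega) (m - (t + 2))) hc)
      (mul_mem_padicMultiples_right (prime_pow_mem_padicMultiples 3)
        (prime_pow_mul_inv_succ_mem hp7 (t := t + 2) (by omega)))
    convert h using 1
    rw [show t + 2 + 1 = 1 + 3 + (t + 2 - 3) by omega, pow_add, pow_add, pow_one]
    ring

/-- The sum of the `m`-th powers below `p ^ 2` is `p ^ 2 * bernoulli m` modulo `p ^ 4`. -/
theorem sum_range_sq_pow_sub_mem_padicMultiples_four (hp7 : 7 ≤ p) {m : ℕ} (hm : Even m)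
    (hm4 : 4 ≤ m) :
    ∑ k ∈ range (p ^ 2), (k : ℚ) ^ m - p ^ 2 * bernoulli m ∈ padicMultiples p 4 := by
  have h0 := sum_range_pow_sub_eq (n := p ^ 2) hm hm4
  rw [Nat.cast_pow] at h0
  rw [h0]
  refine sum_mem fun t _ => ?_
  have hc := natCast_mem_padicMultiples_zero (p := p) (m.choose (t + 2))
  have hB := prime_mul_bernoulli_mem_padicMultiples_zero (p := p) (by omega) (m - (t + 2))
  rcases Nat.eq_zero_or_pos t with rfl | ht
  -- Here the cubic term carries p⁶, so a factor p can be spent on the denominator of B_{m-2}.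
  · have h3 := inv_natCast_mem_padicMultiples_zero_of_lt (p := p) (k := 3) (by omega) (by omega)
    have h := mul_mem_padicMultiples_left (mul_mem_padicMultiples_left hB hc)
      (mul_mem_padicMultiples_right (padicMultiples_anti (show 4 ≤ 5 by omega)
        (prime_pow_mem_padicMultiples 5)) h3)
    convert h using 1
    ring
  · have h := mul_mem_padicMultiples_left (mul_mem_padicMultiples_left hB hc)
      (mul_mem_padicMultiples_right (padicMultiples_anti (show 4 ≤ t + 6 by omega)
        (prime_pow_mem_padicMultiples (t + 6)))
        (prime_pow_mul_inv_succ_mem hp7 (t := t + 2) (by omega)))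
    convert h using 1
    rw [← pow_mul, show 2 * (t + 2 + 1) = 1 + (t + 6) + (t + 2 - 3) by omega, pow_add, pow_add,
      pow_one]
    ring

end Bernoulli

/-! ### Voronoi's congruence. -/

section Voronoi

/-- Expand (x - n⌊x/n⌋)^{m+1} to first order in n. -/
theorem dvd_pow_sub_pow_mod_sub (x n m : ℕ) :
    (n : ℤ) ^ 2 ∣ (x : ℤ) ^ (m + 1) - ((x % n : ℕ) : ℤ) ^ (m + 1)
      - (m + 1) * n * ((x : ℤ) ^ m * ((x / n : ℕ) : ℤ)) := by
  obtain ⟨k, hk⟩ := Polynomial.powAddExpansion (x : ℤ) (-(n * (x / n : ℕ))) (m + 1)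
  have hx : ((x % n : ℕ) : ℤ) = x + -(n * (x / n : ℕ)) := by
    push_cast
    linear_combination Int.emod_add_mul_ediv (x : ℤ) n
  rw [hx, hk]
  refine ⟨-k * ((x / n : ℕ) : ℤ) ^ 2, ?_⟩
  rw [Nat.add_sub_cancel]
  push_cast
  ring

theorem sum_range_mul_mod_eq {M : Type*} [AddCommMonoid M] {a n : ℕ} (h : a.Coprime n)
    (f : ℕ → M) : ∑ j ∈ range n, f (a * j % n) = ∑ j ∈ range n, f j := by
  rcases Nat.eq_zero_or_pos n with rfl | hn
  · simp
  have hinj : ∀ i ∈ range n, ∀ j ∈ range n, a * i % n = a * j % n → i = j := by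
    intro i hi j hj hij
    have h1 : i ≡ j [MOD n] := Nat.ModEq.cancel_left_of_coprime h.symm hij
    exact h1.eq_of_lt_of_lt (mem_range.1 hi) (mem_range.1 hj)
  refine sum_bij (fun j _ => a * j % n) (fun j _ => mem_range.2 (Nat.mod_lt _ hn)) ?_ ?_
    fun _ _ => rfl
  · exact fun i hi j hj hij => hinj i hi j hj hij
  · intro b hb
    obtain ⟨j, hj, hjb⟩ := surj_on_of_inj_on_of_card_le (fun j (_ : j ∈ range n) => a * j % n)
      (fun j _ => mem_range.2 (Nat.mod_lt _ hn)) (fun i j hi hj hij => hinj i hi j hj hij)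
      le_rfl b hb
    exact ⟨j, hj, hjb.symm⟩

/-- The sum `∑ (a * j) ^ m * ⌊a * j / n⌋` over `0 ≤ j < n` of Voronoi's congruence. -/
def voronoiSum (a n m : ℕ) : ℤ :=
  ∑ j ∈ range n, ((a * j : ℕ) : ℤ) ^ m * ((a * j / n : ℕ) : ℤ)

theorem sq_dvd_pow_sub_one_mul_sum_pow_sub {a n : ℕ} (h : a.Coprime n) (m : ℕ) :
    (n : ℤ) ^ 2 ∣ ((a : ℤ) ^ (m + 1) - 1) * ∑ j ∈ range n, (j : ℤ) ^ (m + 1)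
      - (m + 1) * n * voronoiSum a n m := by
  have h1 : ((a : ℤ) ^ (m + 1) - 1) * ∑ j ∈ range n, (j : ℤ) ^ (m + 1)
      - (m + 1) * n * voronoiSum a n m = ∑ j ∈ range n, (((a * j : ℕ) : ℤ) ^ (m + 1)
        - ((a * j % n : ℕ) : ℤ) ^ (m + 1)
        - (m + 1) * n * (((a * j : ℕ) : ℤ) ^ m * ((a * j / n : ℕ) : ℤ))) := by
    rw [sum_sub_distrib, sum_sub_distrib, ← mul_sum,
      sum_range_mul_mod_eq h (fun j => (j : ℤ) ^ (m + 1)), voronoiSum, sub_mul, one_mul, mul_sum]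
    simp only [Nat.cast_mul, mul_pow]
  rw [h1]
  exact dvd_sum fun j _ => dvd_pow_sub_pow_mod_sub _ _ _

variable {p : ℕ} [hp : Fact p.Prime]

theorem prime_dvd_pow_mul_pow_sub_one (x : ℤ) {m : ℕ} (hm : 1 ≤ m) :
    (p : ℤ) ∣ x ^ m * (x ^ (p - 1) - 1) := by
  by_cases hx : (p : ℤ) ∣ x
  · exact ((hx.trans (dvd_pow_self x (by omega)))).mul_right _
  · refine Dvd.dvd.mul_left ?_ _
    refine (Int.ModEq.pow_card_sub_one_eq_one hp.out ?_).symm.dvd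
    exact ((Nat.prime_iff_prime_int.1 hp.out).coprime_iff_not_dvd.2 hx).symm

/-- Fermat applies unless p divides x, in which case x^m supplies p²; hence m ≥ 2. -/
theorem prime_sq_dvd_pow_mul_pow_sub_one_sq (x : ℤ) {m : ℕ} (hm : 2 ≤ m) :
    (p : ℤ) ^ 2 ∣ x ^ m * (x ^ (p - 1) - 1) ^ 2 := by
  by_cases hx : (p : ℤ) ∣ x
  · exact ((pow_dvd_pow_of_dvd hx 2).trans (pow_dvd_pow x hm)).mul_right _
  · refine Dvd.dvd.mul_left (pow_dvd_pow_of_dvd ?_ 2) _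
    refine (Int.ModEq.pow_card_sub_one_eq_one hp.out ?_).symm.dvd
    exact ((Nat.prime_iff_prime_int.1 hp.out).coprime_iff_not_dvd.2 hx).symm

theorem dvd_voronoiSum_sub (a n : ℕ) {m : ℕ} (hm : 1 ≤ m) :
    (p : ℤ) ∣ voronoiSum a n (m + (p - 1)) - voronoiSum a n m := by
  rw [voronoiSum, voronoiSum, ← sum_sub_distrib]
  refine dvd_sum fun j _ => ?_
  convert (prime_dvd_pow_mul_pow_sub_one (p := p) ((a * j : ℕ) : ℤ) hm).mul_right
    ((a * j / n : ℕ) : ℤ) using 1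
  ring

theorem sq_dvd_voronoiSum_second_difference (a n : ℕ) {m : ℕ} (hm : 2 ≤ m) :
    (p : ℤ) ^ 2 ∣ voronoiSum a n (m + 2 * (p - 1)) - 2 * voronoiSum a n (m + (p - 1))
      + voronoiSum a n m := by
  rw [voronoiSum, voronoiSum, voronoiSum, mul_sum, ← sum_sub_distrib, ← sum_add_distrib]
  refine dvd_sum fun j _ => ?_
  convert (prime_sq_dvd_pow_mul_pow_sub_one_sq (p := p) ((a * j : ℕ) : ℤ) hm).mul_right
    ((a * j / n : ℕ) : ℤ) using 1
  ring

/-- Voronoi's congruence for `bernoulli m / m` modulo `p ^ 2`. -/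
theorem pow_sub_one_mul_bernoulli_div_sub_voronoiSum_mem (hp7 : 7 ≤ p) {a : ℕ} (ha : a.Coprime p)
    {m : ℕ} (hm : Odd m) (hm3 : 3 ≤ m) (hpm : ¬ p ∣ m + 1) :
    ((a : ℚ) ^ (m + 1) - 1) * (bernoulli (m + 1) * ((m + 1 : ℕ) : ℚ)⁻¹)
      - voronoiSum a (p ^ 2) m ∈ padicMultiples p 2 := by
  have h1 := sum_range_sq_pow_sub_mem_padicMultiples_four hp7 (m := m + 1) hm.add_one (by omega)
  have h2 : (((((a : ℤ) ^ (m + 1) - 1) * ∑ j ∈ range (p ^ 2), (j : ℤ) ^ (m + 1)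
      - (m + 1) * (p ^ 2 : ℕ) * voronoiSum a (p ^ 2) m : ℤ)) : ℚ) ∈ padicMultiples p 4 := by
    rw [intCast_mem_padicMultiples_iff]
    have := sq_dvd_pow_sub_one_mul_sum_pow_sub (ha.pow_right 2) m
    rw [Nat.cast_pow, ← pow_mul] at this
    rwa [Nat.cast_pow]
  have h3 : (a : ℚ) ^ (m + 1) - 1 ∈ padicMultiples p 0 := by
    simpa using intCast_mem_padicMultiples_zero (p := p) ((a : ℤ) ^ (m + 1) - 1)
  have h4 := inv_natCast_mem_padicMultiples_zero hpm
  -- Modulus n = p² gives precision p⁴; cancelling n leaves p².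
  refine mem_padicMultiples_of_prime_pow_mul 2 ?_
  have h5 := mul_mem_padicMultiples_left h4 (sub_mem h2 (mul_mem_padicMultiples_left h3 h1))
  convert h5 using 1
  have h6 : ((m + 1 : ℕ) : ℚ) ≠ 0 := by positivity
  push_cast at h6 ⊢
  field_simp
  ring

end Voronoi

/-! ### Kummer congruences and the evaluation of h_2. -/

section Kummer

variable {p : ℕ} [hp : Fact p.Prime]

/-- Reason for the base a = 2^p: a^{p-1} = 2^{φ(p²)} ≡ 1 mod p², so the Voronoi factor a^{m+1} - 1
is unchanged mod p² when m moves by p - 1. -/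
theorem sq_dvd_two_pow_prime_pow_sub_one (hp3 : 3 ≤ p) :
    (p : ℤ) ^ 2 ∣ ((2 ^ p : ℕ) : ℤ) ^ (p - 1) - 1 := by
  have hc : (2 : ℕ).Coprime (p ^ 2) :=
    Nat.Coprime.pow_right 2 ((Nat.coprime_primes Nat.prime_two hp.out).2 (by omega))
  have h := Nat.ModEq.pow_totient hc
  rw [Nat.totient_prime_pow hp.out (by omega), Nat.add_one_sub_one, pow_one, pow_mul] at h
  have h' := (Int.natCast_modEq_iff.2 h).symm.dvd
  push_cast at h' ⊢
  exact h'

/-- Since 2^p ≡ 2 mod p, 2^{p-3} ≡ 1 would give 4 ≡ 2^{p-1} ≡ 1, so p would divide 3. -/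
theorem not_prime_dvd_two_pow_prime_pow_sub_one (hp5 : 5 ≤ p) :
    ¬ (p : ℤ) ∣ ((2 ^ p : ℕ) : ℤ) ^ (p - 3) - 1 := by
  intro h
  have h1 := (ZMod.intCast_zmod_eq_zero_iff_dvd _ p).2 h
  have h2 := (ZMod.intCast_zmod_eq_zero_iff_dvd _ p).2
    ((dvd_pow_self (p : ℤ) two_ne_zero).trans (sq_dvd_two_pow_prime_pow_sub_one (p := p) (by omega)))
  push_cast at h1 h2
  rw [ZMod.pow_card] at h1 h2
  rw [show p - 1 = p - 3 + 2 by omega, pow_add] at h2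
  have h3 : ((3 : ℕ) : ZMod p) = 0 := by
    push_cast
    linear_combination h2 - 4 * h1
  rw [ZMod.natCast_eq_zero_iff] at h3
  exact absurd (Nat.le_of_dvd (by omega) h3) (by omega)

theorem not_prime_dvd_of_add_eq_mul {p m c d : ℕ} (h : m + c = d * p) (hc : 0 < c) (hcp : c < p) :
    ¬ p ∣ m := fun hm =>
  (Nat.le_of_dvd hc ((Nat.dvd_add_right hm).1 (h ▸ dvd_mul_left p d))).not_gt hcp

theorem voronoi_bernoulli_mem (hp7 : 7 ≤ p) {m c d : ℕ} (h : m + 1 + c = d * p) (hm : Odd m)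
    (hm3 : 3 ≤ m) (hc : 0 < c) (hcp : c < p) :
    (((2 ^ p : ℕ) : ℚ) ^ (m + 1) - 1) * (bernoulli (m + 1) * ((m + 1 : ℕ) : ℚ)⁻¹)
      - voronoiSum (2 ^ p) (p ^ 2) m ∈ padicMultiples p 2 :=
  pow_sub_one_mul_bernoulli_div_sub_voronoiSum_mem hp7
    (Nat.Coprime.pow_left p ((Nat.coprime_primes Nat.prime_two hp.out).2 (by omega))) hm hm3
    (not_prime_dvd_of_add_eq_mul h hc hcp)

theorem not_sub_one_dvd_of_add_eq_mul {p m c d : ℕ} (h : m + c = d * (p - 1)) (hc : 0 < c)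
    (hcp : c < p - 1) : ¬ (p - 1) ∣ m := fun hm =>
  (Nat.le_of_dvd hc ((Nat.dvd_add_right hm).1 (h ▸ dvd_mul_left (p - 1) d))).not_gt hcp

theorem bernoulli_div_mem {m c d : ℕ} (hp7 : 7 ≤ p) (h : m + c = d * p) (hc : 0 < c)
    (hcp : c < p) (hB : ¬ (p - 1) ∣ m) : bernoulli m * (m : ℚ)⁻¹ ∈ padicMultiples p 0 :=
  mul_mem_padicMultiples_left (bernoulli_mem_padicMultiples_zero (by omega) hB)
    (inv_natCast_mem_padicMultiples_zero (not_prime_dvd_of_add_eq_mul h hc hcp))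

theorem two_pow_prime_pow_sub_mem (hp3 : 3 ≤ p) (m : ℕ) :
    ((2 ^ p : ℕ) : ℚ) ^ (m + (p - 1)) - ((2 ^ p : ℕ) : ℚ) ^ m ∈ padicMultiples p 2 := by
  have h := mul_mem_padicMultiples_left
    (pow_mem_padicMultiples_zero (natCast_mem_padicMultiples_zero (p := p) (2 ^ p)) m)
    (intCast_mem_padicMultiples_iff.2 (sq_dvd_two_pow_prime_pow_sub_one hp3))
  convert h using 1
  push_cast
  ring

theorem mem_of_two_pow_prime_pow_sub_one_mul (hp5 : 5 ≤ p) {x : ℚ} {r : ℕ}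
    (h : (((2 ^ p : ℕ) : ℚ) ^ (p - 3) - 1) * x ∈ padicMultiples p r) :
    x ∈ padicMultiples p r := by
  refine mem_padicMultiples_of_intCast_mul (not_prime_dvd_two_pow_prime_pow_sub_one hp5) ?_
  convert h using 2
  push_cast
  rfl

theorem bernoulli_div_mem_first (hp7 : 7 ≤ p) :
    bernoulli (p - 3) * ((p - 3 : ℕ) : ℚ)⁻¹ ∈ padicMultiples p 0 :=
  bernoulli_div_mem (c := 3) (d := 1) hp7 (by omega) (by omega) (by omega)
    (not_sub_one_dvd_of_add_eq_mul (c := 2) (d := 1) (by omega) (by omega) (by omega))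

theorem bernoulli_div_mem_second (hp7 : 7 ≤ p) :
    bernoulli (2 * p - 4) * ((2 * p - 4 : ℕ) : ℚ)⁻¹ ∈ padicMultiples p 0 :=
  bernoulli_div_mem (c := 4) (d := 2) hp7 (by omega) (by omega) (by omega)
    (not_sub_one_dvd_of_add_eq_mul (c := 2) (d := 2) (by omega) (by omega) (by omega))

theorem bernoulli_div_mem_third (hp7 : 7 ≤ p) :
    bernoulli (3 * p - 5) * ((3 * p - 5 : ℕ) : ℚ)⁻¹ ∈ padicMultiples p 0 :=
  bernoulli_div_mem (c := 5) (d := 3) hp7 (by omega) (by omega) (by omega)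
    (not_sub_one_dvd_of_add_eq_mul (c := 2) (d := 3) (by omega) (by omega) (by omega))

/-- Kummer's congruence modulo `p`. -/
theorem bernoulli_div_sub_mem (hp7 : 7 ≤ p) :
    bernoulli (2 * p - 4) * ((2 * p - 4 : ℕ) : ℚ)⁻¹ - bernoulli (p - 3) * ((p - 3 : ℕ) : ℚ)⁻¹ ∈
      padicMultiples p 1 := by
  have hodd : Odd p := hp.out.odd_of_ne_two (by omega)
  have v1 := voronoi_bernoulli_mem hp7 (m := p - 4) (c := 3) (d := 1) (by omega) (by grind)
    (by omega) (by omega) (by omega)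
  have v2 := voronoi_bernoulli_mem hp7 (m := p - 4 + (p - 1)) (c := 4) (d := 2) (by omega)
    (by grind) (by omega) (by omega) (by omega)
  have d : ((voronoiSum (2 ^ p) (p ^ 2) (p - 4 + (p - 1))
      - voronoiSum (2 ^ p) (p ^ 2) (p - 4) : ℤ) : ℚ) ∈ padicMultiples p 1 := by
    rw [intCast_mem_padicMultiples_iff, pow_one]
    exact dvd_voronoiSum_sub _ _ (by omega)
  have a2 := two_pow_prime_pow_sub_mem (p := p) (by omega) (p - 3)
  rw [show p - 4 + 1 = p - 3 by omega] at v1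
  rw [show p - 4 + (p - 1) + 1 = 2 * p - 4 by omega] at v2
  rw [show p - 3 + (p - 1) = 2 * p - 4 by omega] at a2
  refine mem_of_two_pow_prime_pow_sub_one_mul (by omega) ?_
  have h := add_mem (padicMultiples_anti (show 1 ≤ 2 by omega) (sub_mem (sub_mem v2 v1)
    (mul_mem_padicMultiples_right a2 (bernoulli_div_mem_second hp7)))) d
  convert h using 1
  rw [Int.cast_sub]
  ring

/-- Kummer's congruence of second order modulo `p ^ 2`. -/
theorem bernoulli_div_second_difference_mem (hp7 : 7 ≤ p) :
    bernoulli (3 * p - 5) * ((3 * p - 5 : ℕ) : ℚ)⁻¹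
      - 2 * (bernoulli (2 * p - 4) * ((2 * p - 4 : ℕ) : ℚ)⁻¹)
      + bernoulli (p - 3) * ((p - 3 : ℕ) : ℚ)⁻¹ ∈ padicMultiples p 2 := by
  have hodd : Odd p := hp.out.odd_of_ne_two (by omega)
  have v1 := voronoi_bernoulli_mem hp7 (m := p - 4) (c := 3) (d := 1) (by omega) (by grind)
    (by omega) (by omega) (by omega)
  have v2 := voronoi_bernoulli_mem hp7 (m := p - 4 + (p - 1)) (c := 4) (d := 2) (by omega)
    (by grind) (by omega) (by omega) (by omega)
  have v3 := voronoi_bernoulli_mem hp7 (m := p - 4 + 2 * (p - 1)) (c := 5) (d := 3) (by omega)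
    (by grind) (by omega) (by omega) (by omega)
  have d := intCast_mem_padicMultiples_iff.2
    (sq_dvd_voronoiSum_second_difference (p := p) (2 ^ p) (p ^ 2) (m := p - 4) (by omega))
  have a2 := two_pow_prime_pow_sub_mem (p := p) (by omega) (p - 3)
  have a3 := two_pow_prime_pow_sub_mem (p := p) (by omega) (2 * p - 4)
  rw [show p - 4 + 1 = p - 3 by omega] at v1
  rw [show p - 4 + (p - 1) + 1 = 2 * p - 4 by omega] at v2
  rw [show p - 4 + 2 * (p - 1) + 1 = 3 * p - 5 by omega] at v3
  rw [show p - 3 + (p - 1) = 2 * p - 4 by omega] at a2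
  rw [show 2 * p - 4 + (p - 1) = 3 * p - 5 by omega] at a3
  have two := natCast_mem_padicMultiples_zero (p := p) 2
  refine mem_of_two_pow_prime_pow_sub_one_mul (by omega) ?_
  -- `a2` and `a3` replace the factors a^{2p-4} - 1 and a^{3p-5} - 1 by a^{p-3} - 1, which is then
  -- cancelled.
  have h := add_mem (sub_mem (add_mem (sub_mem v3 (mul_mem_padicMultiples_left two v2)) v1)
    (sub_mem (mul_mem_padicMultiples_right (add_mem a2 a3) (bernoulli_div_mem_third hp7))
      (mul_mem_padicMultiples_left two
        (mul_mem_padicMultiples_right a2 (bernoulli_div_mem_second hp7))))) d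
  convert h using 1
  push_cast
  ring

/-- Expand k^{-2}(k^{p-1} - 1)³ ≡ 0 mod p³. -/
theorem powerHarmonic_two_sub_sum_pow_mem (hp7 : 7 ≤ p) :
    powerHarmonic 2 (p - 1) - (3 * ∑ k ∈ range p, (k : ℚ) ^ (p - 3)
      - 3 * ∑ k ∈ range p, (k : ℚ) ^ (2 * p - 4) + ∑ k ∈ range p, (k : ℚ) ^ (3 * p - 5)) ∈
      padicMultiples p 3 := by
  have hs (m : ℕ) (hm : m ≠ 0) : ∑ k ∈ range p, (k : ℚ) ^ m =
      ∑ i ∈ range (p - 1), ((i + 1 : ℕ) : ℚ) ^ m := by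
    rw [show range p = range (p - 1 + 1) by rw [Nat.sub_add_cancel hp.out.one_le],
      sum_range_succ', Nat.cast_zero, zero_pow hm, add_zero]
  rw [hs _ (by omega), hs _ (by omega), hs _ (by omega), mul_sum, mul_sum, ← sum_sub_distrib,
    ← sum_add_distrib, powerHarmonic, ← sum_sub_distrib]
  refine sum_mem fun i hi => ?_
  have hi' := mem_range.1 hi
  have h := natCast_pow_card_sub_one_sub_one_mem (p := p) (k := i + 1) (by omega) (by omega)
  have h1 := neg_mem (mul_mem_padicMultiples_left
    (pow_mem_padicMultiples_zero (inv_succ_mem_padicMultiples_zero hi') 2)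
    (mul_mem_padicMultiples (mul_mem_padicMultiples h h) h))
  convert h1 using 1
  have h0 : ((i + 1 : ℕ) : ℚ) ≠ 0 := by positivity
  rw [show 2 * p - 4 = p - 3 + (p - 3) + 2 by omega,
    show 3 * p - 5 = p - 3 + (p - 3) + (p - 3) + 2 + 2 by omega,
    show p - 1 = p - 3 + 2 by omega]
  simp only [pow_add]
  field_simp
  ring

/-- Inserting b_{3p-5} ≡ 2b_{2p-4} - b_{p-3} into 3B_{p-3} - 3B_{2p-4} + B_{3p-5}, with B_m = m b_m,
the multiples of p in the coefficients cancel and 2b_{2p-4} - 4b_{p-3} remains. -/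
theorem powerHarmonic_two_sub_bernoulli_mem (hp7 : 7 ≤ p) :
    powerHarmonic 2 (p - 1) - 2 * (p * (bernoulli (2 * p - 4) * ((2 * p - 4 : ℕ) : ℚ)⁻¹
      - 2 * (bernoulli (p - 3) * ((p - 3 : ℕ) : ℚ)⁻¹))) ∈ padicMultiples p 3 := by
  have hodd : Odd p := hp.out.odd_of_ne_two (by omega)
  have s1 := sum_range_pow_sub_mem_padicMultiples_three hp7 (m := p - 3) (by grind) (by omega)
    (not_sub_one_dvd_of_add_eq_mul (c := 4) (d := 1) (by omega) (by omega) (by omega))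
  have s2 := sum_range_pow_sub_mem_padicMultiples_three hp7 (m := 2 * p - 4) (by grind) (by omega)
    (not_sub_one_dvd_of_add_eq_mul (c := 4) (d := 2) (by omega) (by omega) (by omega))
  have s3 := sum_range_pow_sub_mem_padicMultiples_three hp7 (m := 3 * p - 5) (by grind) (by omega)
    (not_sub_one_dvd_of_add_eq_mul (c := 4) (d := 3) (by omega) (by omega) (by omega))
  have hn (k : ℕ) := natCast_mem_padicMultiples_zero (p := p) k
  have hk := mul_mem_padicMultiples (prime_mem_padicMultiples (p := p))
    (mul_mem_padicMultiples_left (hn (3 * p - 5)) (bernoulli_div_second_difference_mem hp7))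
  have h := add_mem (add_mem (add_mem (powerHarmonic_two_sub_sum_pow_mem hp7)
    (mul_mem_padicMultiples_left (hn 3) (sub_mem s1 s2))) s3) hk
  convert h using 1
  have e1 : bernoulli (p - 3) = ((p - 3 : ℕ) : ℚ) *
      (bernoulli (p - 3) * ((p - 3 : ℕ) : ℚ)⁻¹) := by
    have : ((p - 3 : ℕ) : ℚ) ≠ 0 := by exact_mod_cast (by omega : p - 3 ≠ 0)
    field_simp
  have e2 : bernoulli (2 * p - 4) = ((2 * p - 4 : ℕ) : ℚ) *
      (bernoulli (2 * p - 4) * ((2 * p - 4 : ℕ) : ℚ)⁻¹) := by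
    have : ((2 * p - 4 : ℕ) : ℚ) ≠ 0 := by exact_mod_cast (by omega : 2 * p - 4 ≠ 0)
    field_simp
  have e3 : bernoulli (3 * p - 5) = ((3 * p - 5 : ℕ) : ℚ) *
      (bernoulli (3 * p - 5) * ((3 * p - 5 : ℕ) : ℚ)⁻¹) := by
    have : ((3 * p - 5 : ℕ) : ℚ) ≠ 0 := by exact_mod_cast (by omega : 3 * p - 5 ≠ 0)
    field_simp
  have c1 : ((p - 3 : ℕ) : ℚ) = p - 3 := by rw [Nat.cast_sub (by omega)]; norm_num
  have c2 : ((2 * p - 4 : ℕ) : ℚ) = 2 * p - 4 := by rw [Nat.cast_sub (by omega)]; norm_num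
  have c3 : ((3 * p - 5 : ℕ) : ℚ) = 3 * p - 5 := by rw [Nat.cast_sub (by omega)]; norm_num
  generalize bernoulli (p - 3) * ((p - 3 : ℕ) : ℚ)⁻¹ = b1 at *
  generalize bernoulli (2 * p - 4) * ((2 * p - 4 : ℕ) : ℚ)⁻¹ = b2 at *
  generalize bernoulli (3 * p - 5) * ((3 * p - 5 : ℕ) : ℚ)⁻¹ = b3 at *
  rw [e1, e2, e3, c1, c2, c3]
  push_cast
  ring

theorem sum_harmonic_div_sq_sub_bernoulli_mem (hp7 : 7 ≤ p) :
    ∑ i ∈ range (p - 1), harmonic (i + 1) * ((i + 1 : ℕ) : ℚ)⁻¹ ^ 2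
      - 3 * (bernoulli (2 * p - 4) * ((2 * p - 4 : ℕ) : ℚ)⁻¹
        - 2 * (bernoulli (p - 3) * ((p - 3 : ℕ) : ℚ)⁻¹)) ∈ padicMultiples p 2 := by
  refine mem_padicMultiples_of_natCast_mul (k := 2) (by omega) (by omega) ?_
  refine mem_padicMultiples_of_prime_mul ?_
  have h := add_mem (prime_mul_sum_harmonic_div_sq_sub_mem hp7) (mul_mem_padicMultiples_left
    (natCast_mem_padicMultiples_zero 3) (powerHarmonic_two_sub_bernoulli_mem hp7))
  convert h using 1
  push_cast
  ring

end Kummer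

/-! ### Assembly of the final congruences. -/

theorem sum_Icc_one_eq_sum_range (f : ℕ → ℚ) (n : ℕ) :
    ∑ k ∈ Icc 1 n, f k = ∑ i ∈ range n, f (i + 1) := by
  rw [range_eq_Ico, sum_Ico_add' f 0 n 1, zero_add]
  rfl

end

theorem corollary1p2 (p : ℕ) (hp : p.Prime) (hp7 : 7 ≤ p) :
    (RatModEq (p ^ 2) (∑ k ∈ Finset.Icc 1 (p - 1), harmonic k ^ 2 / (k : ℚ))
        (∑ k ∈ Finset.Icc 1 (p - 1), harmonic k / (k : ℚ) ^ 2) ∧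
      RatModEq (p ^ 2) (∑ k ∈ Finset.Icc 1 (p - 1), harmonic k / (k : ℚ) ^ 2)
        (3 * (bernoulli (2 * p - 4) / (2 * (p : ℚ) - 4)
          - 2 * bernoulli (p - 3) / ((p : ℚ) - 3)))) ∧
    (RatModEq p (∑ k ∈ Finset.Icc 1 (p - 1), harmonic k ^ 2 / (k : ℚ))
        (∑ k ∈ Finset.Icc 1 (p - 1), harmonic k / (k : ℚ) ^ 2) ∧
      RatModEq p (∑ k ∈ Finset.Icc 1 (p - 1), harmonic k / (k : ℚ) ^ 2)
        (bernoulli (p - 3))) := by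
  have : Fact p.Prime := ⟨hp⟩
  have eA : ∑ k ∈ Finset.Icc 1 (p - 1), harmonic k ^ 2 / (k : ℚ) =
      ∑ i ∈ Finset.range (p - 1), harmonic (i + 1) ^ 2 * ((i + 1 : ℕ) : ℚ)⁻¹ := by
    simp only [sum_Icc_one_eq_sum_range, div_eq_mul_inv]
  have eB : ∑ k ∈ Finset.Icc 1 (p - 1), harmonic k / (k : ℚ) ^ 2 =
      ∑ i ∈ Finset.range (p - 1), harmonic (i + 1) * ((i + 1 : ℕ) : ℚ)⁻¹ ^ 2 := by
    simp only [sum_Icc_one_eq_sum_range, div_eq_mul_inv, inv_pow]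
  have c1 : ((p - 3 : ℕ) : ℚ) = p - 3 := by rw [Nat.cast_sub (by omega)]; norm_num
  have c2 : ((2 * p - 4 : ℕ) : ℚ) = 2 * p - 4 := by rw [Nat.cast_sub (by omega)]; norm_num
  have eC : 3 * (bernoulli (2 * p - 4) / (2 * (p : ℚ) - 4)
      - 2 * bernoulli (p - 3) / ((p : ℚ) - 3)) =
      3 * (bernoulli (2 * p - 4) * ((2 * p - 4 : ℕ) : ℚ)⁻¹
        - 2 * (bernoulli (p - 3) * ((p - 3 : ℕ) : ℚ)⁻¹)) := by
    rw [c1, c2, div_eq_mul_inv, div_eq_mul_inv, mul_assoc]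
  rw [eA, eB, eC]
  have hn (k : ℕ) := natCast_mem_padicMultiples_zero (p := p) k
  have hA : ∑ i ∈ Finset.range (p - 1), harmonic (i + 1) ^ 2 * ((i + 1 : ℕ) : ℚ)⁻¹ ∈
      padicMultiples p 0 := sum_mem fun i hi => by
    have hi' := Finset.mem_range.1 hi
    exact mul_mem_padicMultiples_left (pow_mem_padicMultiples_zero
      (harmonic_mem_padicMultiples_zero (by omega)) 2) (inv_succ_mem_padicMultiples_zero hi')
  have hAB := sum_harmonic_sq_div_sub_mem hp7
  have hBC := sum_harmonic_div_sq_sub_bernoulli_mem hp7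
  have hb1 := bernoulli_div_mem_first hp7
  have hb2 := bernoulli_div_mem_second hp7
  have hC := mul_mem_padicMultiples_left (hn 3) (sub_mem hb2 (mul_mem_padicMultiples_left (hn 2) hb1))
  have hB := sub_mem hA (padicMultiples_anti (Nat.zero_le 2) hAB)
  rw [sub_sub_cancel] at hB
  have e1 : bernoulli (p - 3) = ((p - 3 : ℕ) : ℚ) *
      (bernoulli (p - 3) * ((p - 3 : ℕ) : ℚ)⁻¹) := by
    have : ((p - 3 : ℕ) : ℚ) ≠ 0 := by exact_mod_cast (by omega : p - 3 ≠ 0)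
    field_simp
  have hD : bernoulli (p - 3) ∈ padicMultiples p 0 := by
    rw [e1]
    exact mul_mem_padicMultiples_left (hn _) hb1
  have hBD : ∑ i ∈ Finset.range (p - 1), harmonic (i + 1) * ((i + 1 : ℕ) : ℚ)⁻¹ ^ 2
      - bernoulli (p - 3) ∈ padicMultiples p 1 := by
    -- Mod p, 3(b_{2p-4} - 2b_{p-3}) ≡ -3b_{p-3} ≡ (p-3)b_{p-3} = B_{p-3}.
    have h := sub_mem (add_mem (padicMultiples_anti (show 1 ≤ 2 by omega) hBC)
      (mul_mem_padicMultiples_left (hn 3) (bernoulli_div_sub_mem hp7)))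
      (mul_mem_padicMultiples_right prime_mem_padicMultiples hb1)
    convert h using 1
    rw [c1] at e1
    nth_rewrite 1 [e1]
    rw [c1]
    push_cast
    ring
  refine ⟨⟨ratModEq_of_sub_mem hA hB hAB, ratModEq_of_sub_mem hB hC hBC⟩, ?_, ?_⟩
  · simpa using ratModEq_of_sub_mem (r := 1) hA hB (padicMultiples_anti (by omega) hAB)
  · simpa using ratModEq_of_sub_mem (r := 1) hB hD hBD
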